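/- A \emph{(combinatorial) $2$-complex} is a cell complex obtained from a graph $\Gamma$ (loops and multiple edges allowed) and a family of disjoint polygons by attaching each $n$-gon ($n\ge 1$) along a closed combinatorial path of length $n$ in $\Gamma$. A $2$-complex $X$ is \emph{link-connected} if it has no isolated vertices, every edge occurs in at least one attaching path, and for every vertex $u$ of $X$ the link of $u$ in $X$ is a connected graph. Here the link of $u$ is the graph whose vertices are the ends of edges of $X$ at $u$ and which has, for each corner of a polygon that is mapped to $u$, one edge joining the two ends of edges that meet at this corner. \textbf{Theorem.} Every group is isomorphic to the fundamental group of a wedge product (with the quotient topology) of a family of circles and a family of connected, link-connected $2$-complexes based at vertices. (Both families may be infinite or empty; the empty wedge product is a point.) -/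

import Mathlib

universe u

/-- A combinatorial `2`-complex: a graph with vertices `V` and edges `E` (loops and multiple edges
allowed, every edge with a chosen orientation), and a family of polygons indexed by `F`.  The
polygon `f` is a `size f`-gon; its sides are indexed cyclically by `ZMod (size f)`, and it is
attached along the closed combinatorial path `k ↦ side f k`.  A pair `(e, true)` is the edge `e`
with its chosen orientation and `(e, false)` is the same edge with the opposite orientation. -/
structure TwoComplex : Type (u + 1) where
  V : Type u
  E : Type u
  src : E → V
  tgt : E → V
  F : Type u
  size : F → ℕ
  size_pos : ∀ f, 0 < size f
  side : (f : F) → ZMod (size f) → E × Bool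
  closed : ∀ f k,
    (if (side f k).2 then tgt (side f k).1 else src (side f k).1) =
      (if (side f (k + 1)).2 then src (side f (k + 1)).1 else tgt (side f (k + 1)).1)

namespace TwoComplex

variable (X : TwoComplex.{u})

/-- The initial vertex of an oriented edge. -/
def origin (d : X.E × Bool) : X.V := if d.2 then X.src d.1 else X.tgt d.1

/-- The same edge with the opposite orientation. -/
def rev (d : X.E × Bool) : X.E × Bool := (d.1, !d.2)

/-! ### The underlying topological space -/

/-- The disjoint union of the vertices, of a unit interval for every edge and of a closed unit
disc for every polygon (`V` carries the discrete topology, as a disjoint union of points). -/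
abbrev Cells : Type u :=
  (Σ _ : X.V, PUnit.{u + 1}) ⊕ ((Σ _ : X.E, unitInterval) ⊕
    (Σ _ : X.F, Metric.closedBall (0 : ℂ) 1))

/-- The vertex `v`, as a point of the disjoint union of the cells. -/
def vertexPt (v : X.V) : X.Cells := Sum.inl ⟨v, PUnit.unit⟩

/-- The point with parameter `t` on the edge `e` (from `src e` to `tgt e`). -/
def edgePt (e : X.E) (t : unitInterval) : X.Cells := Sum.inr (Sum.inl ⟨e, t⟩)

/-- The point with parameter `t` on an oriented edge. -/
def dartPt (d : X.E × Bool) (t : unitInterval) : X.Cells :=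
  X.edgePt d.1 (if d.2 then t else unitInterval.symm t)

/-- The point `z` of the polygon `f`. -/
def facePt (f : X.F) (z : Metric.closedBall (0 : ℂ) 1) : X.Cells := Sum.inr (Sum.inr ⟨f, z⟩)

/-- The point with parameter `t` on the side number `k` of the `n`-gon: the unit circle is divided
into the `n` arcs between consecutive `n`-th roots of unity. -/
noncomputable def sidePt (n : ℕ) (k : ZMod n) (t : unitInterval) :
    Metric.closedBall (0 : ℂ) 1 :=
  ⟨Complex.exp (((2 * Real.pi * (((k.val : ℝ) + (t : ℝ)) / (n : ℝ)) : ℝ) : ℂ) * Complex.I), by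
    rw [mem_closedBall_zero_iff, Complex.norm_exp_ofReal_mul_I]⟩

/-- The identifications: the ends of an edge are glued to its end vertices, and the sides of a
polygon are glued to the edges of the attaching path. -/
inductive Glue : X.Cells → X.Cells → Prop
  | src (e : X.E) : Glue (X.edgePt e 0) (X.vertexPt (X.src e))
  | tgt (e : X.E) : Glue (X.edgePt e 1) (X.vertexPt (X.tgt e))
  | side (f : X.F) (k : ZMod (X.size f)) (t : unitInterval) :
      Glue (X.facePt f (sidePt (X.size f) k t)) (X.dartPt (X.side f k) t)

/-- The topological space of the complex, with the quotient topology. -/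
def Realization : Type u := Quot X.Glue

instance : TopologicalSpace X.Realization :=
  inferInstanceAs (TopologicalSpace (Quot X.Glue))

/-- The vertex `v`, as a point of the space of the complex. -/
def vertex (v : X.V) : X.Realization := Quot.mk X.Glue (X.vertexPt v)

/-! ### Vertex links -/

/-- `X` is a polygon quotient: it has no isolated vertices, and every edge occurs in at least one
attaching path. -/
def IsPolygonQuotient : Prop :=
  (∀ v : X.V, ∃ d : X.E × Bool, X.origin d = v) ∧
    ∀ e : X.E, ∃ f k, (X.side f k).1 = e

/-- The link of a vertex `v`.  Its vertices are the ends of edges at `v`, where `(e, true)` stands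
for the end of `e` at `src e` and `(e, false)` for the end of `e` at `tgt e`.  Each corner at `v`
of a polygon, where the side `k` ends and the side `k + 1` starts, gives an edge of the link that
joins the two ends of edges that meet there.  (Loops and multiplicities of edges of the link are
not recorded, as they do not matter for its connectedness.) -/
def link (v : X.V) : SimpleGraph {d : X.E × Bool // X.origin d = v} :=
  SimpleGraph.fromRel fun a b =>
    ∃ f k, a.1 = X.rev (X.side f k) ∧ b.1 = X.side f (k + 1)

/-- A link-connected `2`-complex: a polygon quotient all of whose vertex links are connected. -/
def IsLinkConnected : Prop :=
  X.IsPolygonQuotient ∧ ∀ v : X.V, (X.link v).Connected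

end TwoComplex

/-! ### Wedge products -/

section Wedge

variable (S : Type u) {J : Type u} (K : J → TwoComplex.{u}) (v : (j : J) → (K j).V)

/-- The disjoint union of a point, of a circle for every `s : S` and of all the complexes `K j`. -/
abbrev WedgePieces : Type u :=
  PUnit.{u + 1} ⊕ ((Σ _ : S, Circle) ⊕ (Σ j : J, (K j).Realization))

/-- All base points (the point `1` of each circle and the vertex `v j` of each complex `K j`) are
identified with the extra point; so the empty wedge is a point. -/
inductive WedgeGlue : WedgePieces S K → WedgePieces S K → Prop
  | circle (s : S) : WedgeGlue (Sum.inr (Sum.inl ⟨s, 1⟩)) (Sum.inl PUnit.unit)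
  | complex (j : J) : WedgeGlue (Sum.inr (Sum.inr ⟨j, (K j).vertex (v j)⟩)) (Sum.inl PUnit.unit)

/-- The wedge product of circles indexed by `S` and of the complexes `K j` with base vertices
`v j`, with the quotient topology. -/
def WedgeSpace : Type u := Quot (WedgeGlue S K v)

instance : TopologicalSpace (WedgeSpace S K v) :=
  inferInstanceAs (TopologicalSpace (Quot (WedgeGlue S K v)))

/-- The base point of the wedge product. -/
def wedgePoint : WedgeSpace S K v := Quot.mk (WedgeGlue S K v) (Sum.inl PUnit.unit)

end Wedge

/-!
A single complex suffices: the presentation complex of the multiplication table of `G`, with one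
vertex, an edge for every element of `G` and a triangle with boundary path `g, h, (g * h)⁻¹` for
all `g` and `h` (`TwoComplex.ofGroup`).  It is link-connected as it stands, because the triangle of
`g` and `h` has a corner between the terminal end of `g` and the initial end of `h`, so that in the
link every terminal end is joined to every initial end.  The wedge product has this complex as its
only piece.

The triangles make the homotopy classes of the edges multiply as in `G`, which gives a homomorphism
`TwoComplex.ofGroupHom` from `G` to the fundamental group.

It is surjective since the fundamental group of any polygon quotient with one vertex is generated
by its edges (`TwoComplex.IsPolygonQuotient.subgroup_eq_top`).  In polar coordinates on the
polygons, with radius `r` and with parameter `t` along each side, the sets `r ≠ 0, t ≠ 1 / 2`, and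
`r ≠ 0, t ≠ 0, 1`, and `r < 1` form an open cover of the complex.  Each of them is contracted to
the vertex by a motion that takes every point, within any polygon containing it, to a corner.  By
subdivision every loop is a product of classes that run back along the track of a point under one
such motion and forth along its track under another one
(`FundamentalGroup.subgroup_eq_top_of_open_cover`).  These classes come from paths between corners
of one polygon, hence from edge paths, as a disc is convex.

For injectivity no universal cover of the complex is needed, only a map to some space in which the
edges are seen to be nontrivial.  Let `G` act by left translation on the functions from `[0, 1)` to
`G`, where the distance of two functions is the measure of the set on which they differ.  A
nontrivial translation moves every function to distance `1`, so that the projection to the orbit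
space is a covering map (`UnitIntervalFun.isQuotientCoveringMap`).  Going from the constant function
`1` to the constant function `g` by switching the value from left to right gives a path, whose image
in the orbit space is a loop, and which is taken as the image of the edge `g`.  The boundary of a
triangle then lifts to a closed path of functions, which is filled by cutting off the functions at
the radius (`TwoComplex.toOrbitsFun`).  The image of the edge `g` has a lift that ends at `g`, so
the edge is null-homotopic only if `g = 1`.
-/

open Topology unitInterval

/-! ### Generators of a fundamental group from an open cover -/

section Generation

variable {X : Type*} [TopologicalSpace X]

/-- A class of paths lying in an open set which is contracted to `x₀` along the paths `H x` is the
class that runs to `x₀` along `H x` and back along `H y`. -/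
theorem Path.Homotopic.Quotient.mk_eq_trans_symm_of_contraction {x₀ : X} {U : Set X}
    {H : X → C(I, X)} (hH : ContinuousOn H U) {x y : X}
    (T : Path x x₀) (T' : Path y x₀) (hT : ∀ u, H x u = T u) (hT' : ∀ u, H y u = T' u)
    (h0 : ∀ z ∈ U, H z 0 = z) (h1 : ∀ z ∈ U, H z 1 = x₀)
    (δ : Path x y) (hδ : ∀ s, δ s ∈ U) :
    mk δ = (mk T).trans (mk T').symm := by
  have hc : Continuous fun s => H (δ s) := hH.comp_continuous δ.continuous hδ
  obtain ⟨S, hS⟩ : ∃ S : C(I × I, X), ∀ s u, S (s, u) = H (δ s) u :=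
    ⟨⟨fun p => H (δ p.1) p.2, ContinuousMap.continuous_uncurry_of_continuous ⟨_, hc⟩⟩,
      fun _ _ => rfl⟩
  -- the four sides of the square
  let bot : Path ((0, 0) : I × I) (1, 0) :=
    ⟨⟨fun s => (s, 0), by fun_prop⟩, rfl, rfl⟩
  let right : Path ((1, 0) : I × I) (1, 1) :=
    ⟨⟨fun s => (1, s), by fun_prop⟩, rfl, rfl⟩
  let left : Path ((0, 0) : I × I) (0, 1) :=
    ⟨⟨fun s => (0, s), by fun_prop⟩, rfl, rfl⟩
  let top : Path ((0, 1) : I × I) (1, 1) :=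
    ⟨⟨fun s => (s, 1), by fun_prop⟩, rfl, rfl⟩
  have e00 : S (0, 0) = x := by rw [hS, h0 _ (hδ 0), δ.source]
  have e10 : S (1, 0) = y := by rw [hS, h0 _ (hδ 1), δ.target]
  have e01 : S (0, 1) = x₀ := by rw [hS, h1 _ (hδ 0)]
  have e11 : S (1, 1) = x₀ := by rw [hS, h1 _ (hδ 1)]
  have : ContractibleSpace I := (convex_Icc (0 : ℝ) 1).contractibleSpace ⟨0, by simp⟩
  have key : (bot.trans right).Homotopic (left.trans top) :=
    SimplyConnectedSpace.paths_homotopic _ _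
  have key2 := (key.map S).pathCast e00.symm e11.symm
  have k1 : ((bot.trans right).map S.continuous).cast e00.symm e11.symm = δ.trans T' := by
    rw [Path.map_trans, Path.cast_trans _ _ (hb := e10.symm)]
    congr 1
    · ext s; exact (hS _ _).trans (h0 _ (hδ s))
    · ext s; exact (hS _ _).trans (by rw [δ.target, hT'])
  have k2 : ((left.trans top).map S.continuous).cast e00.symm e11.symm
      = T.trans (Path.refl x₀) := by
    rw [Path.map_trans, Path.cast_trans _ _ (hb := e01.symm)]
    congr 1
    · ext s; exact (hS _ _).trans (by rw [δ.source, hT])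
    · ext s; exact (hS _ _).trans (h1 _ (hδ s))
  rw [k1, k2] at key2
  have key3 : (mk δ).trans (mk T') = mk T := by
    rw [← mk_trans, eq.2 key2]; simp
  rw [← key3, trans_assoc]; simp

/-- Let `X` be covered by open sets `U i`, each contracted in `X` to `x₀` along paths `H i x`.
A subgroup of the fundamental group which contains all the classes that run back along `H i x` and
then forth along `H j x` is the whole group. -/
theorem FundamentalGroup.subgroup_eq_top_of_open_cover {x₀ : X}
    (N : Subgroup (FundamentalGroup X x₀)) {ι : Type*} (U : ι → Set X)
    (hU : ∀ i, IsOpen (U i)) (hcov : ∀ x, ∃ i, x ∈ U i)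
    (H : ι → X → C(I, X)) (hH : ∀ i, ContinuousOn (H i) (U i))
    (h0 : ∀ i, ∀ x ∈ U i, H i x 0 = x) (h1 : ∀ i, ∀ x ∈ U i, H i x 1 = x₀)
    (hN : ∀ i j x (T T' : Path x x₀), x ∈ U i → x ∈ U j → (∀ u, H i x u = T u) →
      (∀ u, H j x u = T' u) →
      FundamentalGroup.fromPath (.trans (.symm (.mk T)) (.mk T')) ∈ N)
    (i₀ : ι) (hi₀ : x₀ ∈ U i₀) (hconst : ∀ u, H i₀ x₀ u = x₀) : N = ⊤ := by
  let T (i) (x) (hx : x ∈ U i) : Path x x₀ := ⟨H i x, h0 i x hx, h1 i x hx⟩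
  have hT : ∀ i x (hx : x ∈ U i) u, H i x u = T i x hx u := fun _ _ _ _ => rfl
  rw [eq_top_iff]
  rintro ⟨γ⟩ -
  obtain ⟨t, t0, tmono, ⟨m, tm⟩, ht⟩ := exists_monotone_Icc_subset_open_cover_unitInterval
    (c := fun i => γ ⁻¹' U i) (fun i => (hU i).preimage γ.continuous)
    (fun s _ => by simpa using hcov (γ s))
  -- the piece of the loop up to `t n`, closed up by tracks of its ends, lies in `N`
  have main : ∀ n i j (hi : γ (t 0) ∈ U i) (hj : γ (t n) ∈ U j),
      FundamentalGroup.fromPath (.trans (.symm (.mk (T i _ hi)))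
        (.trans (.mk (γ.subpath (t 0) (t n))) (.mk (T j _ hj)))) ∈ N := by
    intro n
    induction n with
    | zero =>
      intro i j hi hj
      have := hN i j _ (T i _ hi) (T j _ hj) hi hj (hT _ _ hi) (hT _ _ hj)
      simpa using this
    | succ n ih =>
      intro i j hi hj
      obtain ⟨k, hk⟩ := ht n
      have hn := tmono n.le_succ
      have hk0 : γ (t n) ∈ U k := hk ⟨le_rfl, hn⟩
      have hk1 : γ (t (n + 1)) ∈ U k := hk ⟨hn, le_rfl⟩
      have a := ih i k hi hk0
      have b := hN k j _ (T k _ hk1) (T j _ hj) hk1 hj (hT _ _ hk1) (hT _ _ hj)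
      have c := Path.Homotopic.Quotient.mk_eq_trans_symm_of_contraction (hH k)
        (T k _ hk0) (T k _ hk1) (hT _ _ hk0) (hT _ _ hk1) (h0 k) (h1 k)
        (γ.subpath (t n) (t (n + 1))) (fun s => by
          have : γ.subpath (t n) (t (n + 1)) s ∈ Set.range (γ.subpath (t n) (t (n + 1))) := ⟨s, rfl⟩
          rw [Path.range_subpath_of_le _ _ _ hn] at this
          obtain ⟨s', hs', e⟩ := this
          rw [← e]; exact hk hs')
      have d : Path.Homotopic.Quotient.mk (γ.subpath (t 0) (t (n + 1))) =
          .trans (.mk (γ.subpath (t 0) (t n))) (.mk (γ.subpath (t n) (t (n + 1)))) := by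
        rw [← Path.Homotopic.Quotient.mk_trans, eq_comm, Path.Homotopic.Quotient.eq]
        exact ⟨Path.Homotopy.subpathTransSubpath γ _ _ _⟩
      have e := N.mul_mem b a
      rw [FundamentalGroup.mul_def] at e
      convert e using 1
      rw [d, c]
      simp only [FundamentalGroup.fromPath, FundamentalGroup.fromArrow,
        Path.Homotopic.Quotient.trans_assoc]
  have ex0 : γ (t 0) = x₀ := by rw [t0]; simp
  have ex1 : γ (t m) = x₀ := by rw [tm m le_rfl]; simp
  have hi : γ (t 0) ∈ U i₀ := by rwa [ex0]
  have hj : γ (t m) ∈ U i₀ := by rwa [ex1]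
  have fin := main m i₀ i₀ hi hj
  have r0 : T i₀ _ hi = (Path.refl x₀).cast ex0 rfl := by
    ext u
    exact (congrArg (fun z => H i₀ z u) ex0).trans (hconst u)
  have r1 : T i₀ _ hj = (Path.refl x₀).cast ex1 rfl := by
    ext u
    exact (congrArg (fun z => H i₀ z u) ex1).trans (hconst u)
  have r2 : γ.subpath (t 0) (t m) = γ.cast ex0 ex1 := by
    ext u; simp [Path.subpath, t0, tm m le_rfl]
  rw [r0, r1, r2] at fin
  clear r0 r1 r2 main
  revert fin
  generalize_proofs
  generalize γ (t 0) = a at *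
  generalize γ (t m) = b at *
  subst ex0 ex1
  intro fin
  have hs : (Path.Homotopic.Quotient.refl b).symm = .refl b := by
    rw [← Path.Homotopic.Quotient.mk_refl, ← Path.Homotopic.Quotient.mk_symm, Path.refl_symm]
  simp only [Path.cast_rfl_rfl, Path.Homotopic.Quotient.mk_refl, hs,
    Path.Homotopic.Quotient.refl_trans, Path.Homotopic.Quotient.trans_refl] at fin
  exact fin

end Generation

/-! ### Polar coordinates on a polygon -/

/-- The closed unit disc. -/
abbrev UnitDisc : Type := Metric.closedBall (0 : ℂ) 1

namespace UnitDisc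

/-- The point at parameter `u` on the line segment from `z` to `w`. -/
noncomputable def segment (z w : UnitDisc) (u : I) : UnitDisc :=
  ⟨(1 - (u : ℝ)) • (z : ℂ) + (u : ℝ) • (w : ℂ),
    convex_closedBall (0 : ℂ) 1 z.2 w.2 (by linarith [u.2.2]) u.2.1 (by ring)⟩

theorem segment_zero (z w : UnitDisc) : segment z w 0 = z := by
  ext; simp [segment]

theorem segment_one (z w : UnitDisc) : segment z w 1 = w := by
  ext; simp [segment]

theorem continuous_segment :
    Continuous fun p : UnitDisc × UnitDisc × I => segment p.1 p.2.1 p.2.2 := by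
  unfold segment
  fun_prop

instance : ContractibleSpace UnitDisc :=
  (convex_closedBall (0 : ℂ) 1).contractibleSpace ⟨0, by simp⟩

variable {n : ℕ}

/-- The point at distance `r` from the centre, on the radius through the point with parameter `t`
on the side `k` of an `n`-gon. -/
noncomputable def polar (n : ℕ) (r : I) (k : ZMod n) (t : I) : UnitDisc :=
  segment ⟨0, by simp⟩ (TwoComplex.sidePt n k t) r

theorem coe_polar (r : I) (k : ZMod n) (t : I) :
    (polar n r k t : ℂ) = (r : ℝ) • (TwoComplex.sidePt n k t : ℂ) := by
  simp [polar, segment]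

theorem polar_one (k : ZMod n) (t : I) : polar n 1 k t = TwoComplex.sidePt n k t :=
  segment_one _ _

theorem norm_polar (r : I) (k : ZMod n) (t : I) : ‖(polar n r k t : ℂ)‖ = r := by
  rw [coe_polar, norm_smul, TwoComplex.sidePt, Complex.norm_exp_ofReal_mul_I]
  simp [abs_of_nonneg r.2.1]

theorem continuous_sidePt (k : ZMod n) : Continuous (TwoComplex.sidePt n k) := by
  unfold TwoComplex.sidePt
  fun_prop

theorem continuous_polar (k : ZMod n) : Continuous fun p : I × I => polar n p.1 k p.2 :=
  continuous_segment.comp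
    (continuous_const.prodMk (((continuous_sidePt k).comp continuous_snd).prodMk continuous_fst))

theorem sidePt_eq_iff [NeZero n] {k k' : ZMod n} {t t' : I} :
    TwoComplex.sidePt n k t = TwoComplex.sidePt n k' t' ↔
      ∃ m : ℤ, (k.val : ℝ) + t = k'.val + t' + n * m := by
  have hn : (n : ℝ) ≠ 0 := NeZero.ne _
  rw [TwoComplex.sidePt, TwoComplex.sidePt, Subtype.mk.injEq, Complex.exp_eq_exp_iff_exists_int]
  refine exists_congr fun m => ?_
  have : ((2 * Real.pi * ((k'.val + t') / n) : ℝ) : ℂ) * Complex.I + m * (2 * Real.pi * Complex.I)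
      = ((2 * Real.pi * ((k'.val + t' + n * m) / n) : ℝ) : ℂ) * Complex.I := by
    push_cast
    rw [add_div _ ((n : ℂ) * m), mul_div_cancel_left₀ _ (by exact_mod_cast hn)]
    ring
  rw [this, mul_left_inj' Complex.I_ne_zero, Complex.ofReal_inj,
    mul_right_inj' (by positivity), div_left_inj' hn]

theorem sidePt_succ_zero [NeZero n] (k : ZMod n) :
    TwoComplex.sidePt n (k + 1) 0 = TwoComplex.sidePt n k 1 := by
  rw [sidePt_eq_iff]
  have h : (((k + 1).val : ℤ) : ZMod n) = ((k.val + 1 : ℤ) : ZMod n) := by simp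
  rw [ZMod.intCast_eq_intCast_iff_dvd_sub] at h
  obtain ⟨c, hc⟩ := h
  refine ⟨-c, ?_⟩
  have : ((k.val : ℤ) + 1 : ℝ) - ((k + 1).val : ℤ) = n * c := by exact_mod_cast hc
  push_cast at this ⊢
  linarith

theorem polar_succ_zero [NeZero n] (r : I) (k : ZMod n) : polar n r (k + 1) 0 = polar n r k 1 := by
  rw [polar, polar, sidePt_succ_zero]

/-- Two parameters give the same boundary point only if they are equal or describe the corner
between two consecutive sides. -/
theorem eq_or_corner_of_sidePt_eq [NeZero n] {k k' : ZMod n} {t t' : I}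
    (h : TwoComplex.sidePt n k t = TwoComplex.sidePt n k' t') :
    (k = k' ∧ t = t') ∨ (k' = k + 1 ∧ t = 1 ∧ t' = 0) ∨ (k = k' + 1 ∧ t' = 1 ∧ t = 0) := by
  obtain ⟨m, hm⟩ := sidePt_eq_iff.1 h
  -- the difference `d` of the parameters is an integer, so it is `0`, `1` or `-1`
  obtain ⟨d, hd⟩ : ∃ d : ℤ, (d : ℝ) = (t : ℝ) - t' := ⟨k'.val + n * m - k.val, by
    push_cast; linarith⟩
  have hk : k + d = k' := by
    have : ((k.val + d : ℤ) : ℝ) = ((k'.val + n * m : ℤ) : ℝ) := by push_cast; linarith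
    have := congrArg (Int.cast : ℤ → ZMod n) (Int.cast_injective this)
    simpa using this
  have h1 : -1 ≤ d := by
    have : (-1 : ℝ) ≤ d := by linarith [t.2.1, t'.2.2]
    exact_mod_cast this
  have h2 : d ≤ 1 := by
    have : (d : ℝ) ≤ 1 := by linarith [t.2.2, t'.2.1]
    exact_mod_cast this
  have h3 : d = -1 ∨ d = 0 ∨ d = 1 := by omega
  rcases h3 with rfl | rfl | rfl
  · right; right
    push_cast at hd hk
    exact ⟨by rw [← hk]; ring, Subtype.ext (by push_cast; linarith [t.2.1, t'.2.2]),
      Subtype.ext (by push_cast; linarith [t.2.1, t'.2.2])⟩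
  · left
    push_cast at hd hk
    exact ⟨by simpa using hk, by ext; linarith⟩
  · right; left
    push_cast at hd hk
    exact ⟨hk.symm, Subtype.ext (by push_cast; linarith [t.2.2, t'.2.1]),
      Subtype.ext (by push_cast; linarith [t.2.2, t'.2.1])⟩

theorem exists_polar_eq [NeZero n] (z : UnitDisc) :
    ∃ p : I × ZMod n × I, polar n p.1 p.2.1 p.2.2 = z := by
  have hn : (0 : ℝ) < n := by exact_mod_cast Nat.pos_of_ne_zero (NeZero.ne n)
  have hz : ‖(z : ℂ)‖ ≤ 1 := mem_closedBall_zero_iff.1 z.2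
  -- `a` is the angle of `z`, as a multiple of the angle of one side
  obtain ⟨a, ha0, han, ha⟩ : ∃ a : ℝ, 0 ≤ a ∧ a < n ∧
      (z : ℂ) = ‖(z : ℂ)‖ * Complex.exp (((2 * Real.pi * (a / n) : ℝ) : ℂ) * Complex.I) := by
    have hp := Real.pi_pos
    have key := Complex.norm_mul_exp_arg_mul_I (z : ℂ)
    rcases le_or_gt 0 (Complex.arg z) with h | h
    · refine ⟨Complex.arg z / (2 * Real.pi) * n, by positivity, ?_, ?_⟩
      · have := Complex.arg_le_pi (z : ℂ)
        have : Complex.arg z / (2 * Real.pi) < 1 := by rw [div_lt_one (by positivity)]; linarith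
        nlinarith
      · have e : 2 * Real.pi * (Complex.arg z / (2 * Real.pi) * n / n) = Complex.arg z := by
          field_simp
        rw [e]; exact key.symm
    · refine ⟨(Complex.arg z / (2 * Real.pi) + 1) * n, ?_, ?_, ?_⟩
      · have := Complex.neg_pi_lt_arg (z : ℂ)
        have : -1 < Complex.arg z / (2 * Real.pi) := by rw [lt_div_iff₀ (by positivity)]; linarith
        nlinarith
      · have : Complex.arg z / (2 * Real.pi) < 0 := div_neg_of_neg_of_pos h (by positivity)
        nlinarith
      · have e : 2 * Real.pi * ((Complex.arg z / (2 * Real.pi) + 1) * n / n)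
            = Complex.arg z + 2 * Real.pi := by
          field_simp
        rw [e]; push_cast
        rw [add_mul, Complex.exp_add, Complex.exp_two_pi_mul_I, mul_one]
        exact key.symm
  have hfl : ⌊a⌋₊ < n := (Nat.floor_lt ha0).2 han
  refine ⟨(⟨‖(z : ℂ)‖, norm_nonneg _, hz⟩, (⌊a⌋₊ : ZMod n),
    ⟨a - ⌊a⌋₊, by linarith [Nat.floor_le ha0], by linarith [Nat.lt_floor_add_one a]⟩), ?_⟩
  ext
  rw [coe_polar]
  conv_rhs => rw [ha]
  simp [TwoComplex.sidePt, ZMod.val_natCast, Nat.mod_eq_of_lt hfl]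

/-- The disc is a quotient of squares, one for each side of the polygon. -/
theorem isQuotientMap_polar (n : ℕ) [NeZero n] :
    IsQuotientMap fun p : (Σ _ : ZMod n, I × I) => polar n p.2.1 p.1 p.2.2 := by
  have hc : Continuous fun p : (Σ _ : ZMod n, I × I) => polar n p.2.1 p.1 p.2.2 :=
    continuous_sigma fun k => continuous_polar k
  refine hc.isClosedMap.isQuotientMap hc fun z => ?_
  obtain ⟨⟨r, k, t⟩, h⟩ := exists_polar_eq (n := n) z
  exact ⟨⟨k, r, t⟩, h⟩

section Lift

variable {Y : Type*} [NeZero n]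

/-- The function on the disc which is given in polar coordinates by `φ`. -/
noncomputable def polarLift (φ : I → ZMod n → I → Y) (z : UnitDisc) : Y :=
  let p := (exists_polar_eq (n := n) z).choose
  φ p.1 p.2.1 p.2.2

theorem polarLift_polar {φ : I → ZMod n → I → Y} (h0 : ∀ k k' t t', φ 0 k t = φ 0 k' t')
    (h1 : ∀ r k, φ r (k + 1) 0 = φ r k 1) (r : I) (k : ZMod n) (t : I) :
    polarLift φ (polar n r k t) = φ r k t := by
  have h := (exists_polar_eq (n := n) (polar n r k t)).choose_spec
  unfold polarLift
  generalize (exists_polar_eq (n := n) (polar n r k t)).choose = p at h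
  obtain ⟨r', k', t'⟩ := p
  dsimp only at h ⊢
  have hr : r' = r := by
    ext; rw [← norm_polar r' k' t', h, norm_polar]
  subst hr
  by_cases hr : r' = 0
  · subst hr; exact h0 _ _ _ _
  have hs : TwoComplex.sidePt n k' t' = TwoComplex.sidePt n k t := by
    have := congrArg Subtype.val h
    rw [coe_polar, coe_polar] at this
    exact Subtype.ext (smul_right_injective ℂ (fun h0 => hr (Subtype.ext h0)) this)
  rcases eq_or_corner_of_sidePt_eq hs with ⟨rfl, rfl⟩ | ⟨rfl, rfl, rfl⟩ | ⟨rfl, rfl, rfl⟩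
  · rfl
  · exact (h1 _ _).symm
  · exact h1 _ _

end Lift

end UnitDisc

/-! ### The space of a complex as a quotient of squares -/

namespace TwoComplex

variable (X : TwoComplex.{u})

instance neZero_size (f : X.F) : NeZero (X.size f) := ⟨(X.size_pos f).ne'⟩

/-- The characteristic map of the polygon `f`. -/
def face (f : X.F) : C(UnitDisc, X.Realization) :=
  ⟨fun z => Quot.mk _ (X.facePt f z), continuous_quot_mk.comp <|
    continuous_inr.comp <| continuous_inr.comp continuous_sigmaMk⟩

/-- The characteristic map of the edge `e`. -/
def edge (e : X.E) : C(I, X.Realization) :=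
  ⟨fun t => Quot.mk _ (X.edgePt e t), continuous_quot_mk.comp <|
    continuous_inr.comp <| continuous_inl.comp continuous_sigmaMk⟩

variable {X}

theorem edge_zero (e : X.E) : X.edge e 0 = X.vertex (X.src e) := Quot.sound (.src e)

theorem edge_one (e : X.E) : X.edge e 1 = X.vertex (X.tgt e) := Quot.sound (.tgt e)

theorem face_sidePt (f : X.F) (k : ZMod (X.size f)) (t : I) :
    X.face f (sidePt _ k t) = X.edge (X.side f k).1 (if (X.side f k).2 then t else σ t) :=
  Quot.sound (.side f k t)

theorem face_corner [Subsingleton X.V] (v : X.V) (f : X.F) (k : ZMod (X.size f)) :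
    X.face f (sidePt _ k 0) = X.vertex v := by
  rw [face_sidePt]
  split_ifs
  · rw [edge_zero, Subsingleton.elim v]
  · rw [symm_zero, edge_one, Subsingleton.elim v]

variable (X) in
/-- The polygon `f` cut into squares along the radii through its corners: the point with polar
coordinates `(r, t)` in the sector over the side `k`. -/
noncomputable def square (f : X.F) (k : ZMod (X.size f)) : C(I × I, X.Realization) :=
  (X.face f).comp ⟨fun p => UnitDisc.polar _ p.1 k p.2, UnitDisc.continuous_polar k⟩

theorem square_apply (f : X.F) (k : ZMod (X.size f)) (r t : I) :
    X.square f k (r, t) = X.face f (UnitDisc.polar _ r k t) := rfl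

theorem square_one (f : X.F) (k : ZMod (X.size f)) (t : I) :
    X.square f k (1, t) = X.edge (X.side f k).1 (if (X.side f k).2 then t else σ t) := by
  rw [square_apply, UnitDisc.polar_one, face_sidePt]

theorem IsPolygonQuotient.exists_edge_eq (hX : X.IsPolygonQuotient) (e : X.E) :
    ∃ f k, ∃ τ : C(I, I), ∀ t, X.edge e t = X.square f k (1, τ t) := by
  obtain ⟨f, k, rfl⟩ := hX.2 e
  by_cases h : (X.side f k).2
  · exact ⟨f, k, .id _, fun t => by simp [square_one, h]⟩
  · exact ⟨f, k, ⟨σ, continuous_symm⟩, fun t => by simp [square_one, h]⟩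

theorem IsPolygonQuotient.exists_vertex_eq (hX : X.IsPolygonQuotient) (v : X.V) :
    ∃ e t, X.vertex v = X.edge e t := by
  obtain ⟨⟨e, b⟩, rfl⟩ := hX.1 v
  cases b
  · exact ⟨e, 1, (edge_one e).symm⟩
  · exact ⟨e, 0, (edge_zero e).symm⟩

theorem IsPolygonQuotient.exists_square_eq (hX : X.IsPolygonQuotient) (x : X.Realization) :
    ∃ f k r t, X.square f k (r, t) = x := by
  have hE : ∀ e t, ∃ f k r s, X.square f k (r, s) = X.edge e t := fun e t => by
    obtain ⟨f, k, τ, h⟩ := hX.exists_edge_eq e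
    exact ⟨f, k, 1, τ t, (h t).symm⟩
  obtain ⟨⟨v, ⟨⟩⟩ | ⟨e, t⟩ | ⟨f, z⟩⟩ := x
  · obtain ⟨e, t, h⟩ := hX.exists_vertex_eq v
    obtain ⟨f, k, r, s, h'⟩ := hE e t
    exact ⟨f, k, r, s, h'.trans h.symm⟩
  · exact hE e t
  · obtain ⟨⟨r, k, t⟩, rfl⟩ := UnitDisc.exists_polar_eq (n := X.size f) z
    exact ⟨f, k, r, t, rfl⟩

/-- The space of a polygon quotient carries the quotient topology from the squares. -/
theorem IsPolygonQuotient.isOpen_of_square (hX : X.IsPolygonQuotient) {U : Set X.Realization}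
    (h : ∀ f k, IsOpen (X.square f k ⁻¹' U)) : IsOpen U := by
  change IsOpen (Quot.mk X.Glue ⁻¹' U)
  rw [isOpen_sum_iff, isOpen_sum_iff, isOpen_sigma_iff, isOpen_sigma_iff, isOpen_sigma_iff]
  refine ⟨fun _ => isOpen_discrete _, fun e => ?_, fun f => ?_⟩
  · obtain ⟨f, k, τ, hτ⟩ := hX.exists_edge_eq e
    convert (h f k).preimage (continuous_const.prodMk τ.continuous) using 1
    ext t
    change X.edge e t ∈ U ↔ _
    rw [hτ]; rfl
  · rw [← (UnitDisc.isQuotientMap_polar (X.size f)).isOpen_preimage, isOpen_sigma_iff]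
    exact fun k => h f k

theorem IsPolygonQuotient.continuousOn_of_square {Y : Type*} [TopologicalSpace Y]
    (hX : X.IsPolygonQuotient) {U : Set X.Realization} (hU : IsOpen U) {g : X.Realization → Y}
    (h : ∀ f k, ContinuousOn (g ∘ X.square f k) (X.square f k ⁻¹' U)) : ContinuousOn g U := by
  rw [continuousOn_open_iff hU]
  refine fun W hW => hX.isOpen_of_square fun f k => ?_
  exact (continuousOn_open_iff (hU.preimage (X.square f k).continuous)).1 (h f k) W hW

theorem IsPolygonQuotient.continuous_of_square {Y : Type*} [TopologicalSpace Y]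
    (hX : X.IsPolygonQuotient) {g : X.Realization → Y}
    (h : ∀ f k, Continuous (g ∘ X.square f k)) : Continuous g :=
  continuousOn_univ.1 <| hX.continuousOn_of_square isOpen_univ fun f k => (h f k).continuousOn

/-- A function on the space of a complex, from compatible functions on the cells. -/
def realizationLift {Y : Type*} (fv : X.V → Y) (fe : X.E → I → Y) (ff : X.F → UnitDisc → Y)
    (h0 : ∀ e, fe e 0 = fv (X.src e)) (h1 : ∀ e, fe e 1 = fv (X.tgt e))
    (hs : ∀ f k t, ff f (sidePt _ k t) =
      fe (X.side f k).1 (if (X.side f k).2 then t else σ t)) : X.Realization → Y :=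
  Quot.lift (Sum.elim (fun a => fv a.1) (Sum.elim (fun a => fe a.1 a.2) fun a => ff a.1 a.2)) <| by
    rintro _ _ (e | e | ⟨f, k, t⟩)
    exacts [h0 e, h1 e, hs f k t]

/-! ### Contractible open sets of a complex with one vertex -/

/-- A way to push the points of an open set `dom` of the unit interval, which is symmetric under
reversal, to the ends of the interval. -/
structure EndPush where
  /-- The end to which a point is pushed.  Outside `dom` its only role is to fix both ends. -/
  toEnd : I → I
  /-- The set of the points that are pushed. -/
  dom : Set I
  zero : toEnd 0 = 0
  one : toEnd 1 = 1
  isOpen_dom : IsOpen dom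
  symm_mem : ∀ t ∈ dom, σ t ∈ dom
  eventually_eq : ∀ t ∈ dom, ∀ᶠ s in 𝓝 t, toEnd s = toEnd t
  eq_end : ∀ t ∈ dom, toEnd t = 0 ∨ toEnd t = 1

namespace EndPush

/-- Both halves of the interval are pushed to their own ends. -/
noncomputable def halves : EndPush where
  toEnd t := if (t : ℝ) < 1 / 2 then 0 else 1
  dom := {t | (t : ℝ) ≠ 1 / 2}
  zero := by simp
  one := by norm_num
  isOpen_dom := isOpen_ne_fun (by fun_prop) (by fun_prop)
  symm_mem t ht h := ht (by rw [coe_symm_eq] at h; linarith)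
  eventually_eq t ht := by
    rcases lt_or_gt_of_ne ht with h | h
    · filter_upwards [(isOpen_lt continuous_subtype_val continuous_const).mem_nhds h] with s hs
      rw [if_pos h, if_pos hs]
    · filter_upwards [(isOpen_lt continuous_const continuous_subtype_val).mem_nhds h] with s hs
      rw [if_neg (not_lt_of_gt h), if_neg (not_lt_of_gt hs)]
  eq_end t _ := by split_ifs <;> simp

open Classical in
/-- The interior of the interval is pushed to `0`. -/
noncomputable def interior : EndPush where
  toEnd t := if t = 1 then 1 else 0
  dom := {t | t ≠ 0 ∧ t ≠ 1}
  zero := by simp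
  one := by simp
  isOpen_dom := isOpen_ne.inter isOpen_ne
  symm_mem t ht := ⟨fun h => ht.2 (by simpa using congrArg σ h),
    fun h => ht.1 (by simpa using congrArg σ h)⟩
  eventually_eq t ht := by
    filter_upwards [isOpen_ne.mem_nhds ht.2] with s hs
    rw [if_neg ht.2, if_neg hs]
  eq_end t _ := by split_ifs <;> simp

variable (P : EndPush)

/-- The end to which a point of an oriented edge is pushed, where the orientation is that of the
edge if `b` is `true`. -/
def toEndOn (b : Bool) (t : I) : I := if b then P.toEnd t else σ (P.toEnd (σ t))

theorem symm_mem_iff {t : I} : σ t ∈ P.dom ↔ t ∈ P.dom :=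
  ⟨fun h => by simpa using P.symm_mem _ h, P.symm_mem t⟩

theorem toEndOn_zero (b : Bool) : P.toEndOn b 0 = 0 := by
  cases b <;> simp [toEndOn, P.zero, P.one]

theorem toEndOn_one (b : Bool) : P.toEndOn b 1 = 1 := by
  cases b <;> simp [toEndOn, P.zero, P.one]

theorem toEndOn_eq_end (b : Bool) {t : I} (ht : t ∈ P.dom) :
    P.toEndOn b t = 0 ∨ P.toEndOn b t = 1 := by
  cases b
  · rcases P.eq_end _ (P.symm_mem t ht) with h | h <;> simp [toEndOn, h]
  · simpa [toEndOn] using P.eq_end t ht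

theorem continuousOn_toEndOn (b : Bool) : ContinuousOn (P.toEndOn b) P.dom := by
  have h : ContinuousOn P.toEnd P.dom := fun t ht =>
    (continuousAt_const.congr ((P.eventually_eq t ht).mono fun _ h => h.symm)).continuousWithinAt
  cases b
  · exact continuous_symm.comp_continuousOn (h.comp continuous_symm.continuousOn P.symm_mem)
  · exact h

end EndPush

theorem symm_convexComb (s t u : I) :
    σ (Set.Icc.convexComb s t u) = Set.Icc.convexComb (σ s) (σ t) u := by
  ext
  simp
  ring

open Classical in
/-- The path of the point with polar coordinates `(r, t)` over the side `k` of the polygon `f`, when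
the parameter `t` is pushed to an end by `P` and `r` is pushed to `1`.  At the centre, where this
makes no sense, the path is constant. -/
noncomputable def pushSquare (P : EndPush) (f : X.F) (r : I) (k : ZMod (X.size f)) (t : I) :
    C(I, X.Realization) :=
  if r = 0 then .const _ (X.face f ⟨0, by simp⟩) else
    (X.square f k).comp ⟨fun u => (Set.Icc.convexComb r 1 u,
      Set.Icc.convexComb t (P.toEndOn (X.side f k).2 t) u),
        (Set.Icc.continuous_convexComb _ _).prodMk (Set.Icc.continuous_convexComb _ _)⟩

theorem pushSquare_zero (P : EndPush) (f : X.F) (k k' : ZMod (X.size f)) (t t' : I) :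
    pushSquare P f 0 k t = pushSquare P f 0 k' t' := by
  simp [pushSquare]

theorem pushSquare_succ (P : EndPush) (f : X.F) (r : I) (k : ZMod (X.size f)) :
    pushSquare P f r (k + 1) 0 = pushSquare P f r k 1 := by
  ext u
  unfold pushSquare
  split_ifs
  · rfl
  · simp [P.toEndOn_zero, P.toEndOn_one, square_apply, UnitDisc.polar_succ_zero]

/-- The path of a point of a complex, when the edges are pushed to their ends by `P` and the
polygons are pushed to their boundary along the radii. -/
noncomputable def push (P : EndPush) : X.Realization → C(I, X.Realization) :=
  realizationLift (fun v => .const _ (X.vertex v))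
    (fun e t => (X.edge e).comp ⟨_, Set.Icc.continuous_convexComb t (P.toEnd t)⟩)
    (fun f => UnitDisc.polarLift (pushSquare P f))
    (fun e => by ext u; simp [P.zero, edge_zero])
    (fun e => by ext u; simp [P.one, edge_one])
    (fun f k t => by
      rw [← UnitDisc.polar_one,
        UnitDisc.polarLift_polar (pushSquare_zero P f) (pushSquare_succ P f)]
      ext u
      rw [pushSquare, if_neg one_ne_zero]
      simp only [ContinuousMap.comp_apply, ContinuousMap.coe_mk, Set.Icc.convexComb_eq,
        square_one, EndPush.toEndOn]
      split_ifs <;> simp [symm_convexComb])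

theorem push_square (P : EndPush) (f : X.F) (k : ZMod (X.size f)) {r : I} (hr : r ≠ 0) (t u : I) :
    push P (X.square f k (r, t)) u = X.square f k (Set.Icc.convexComb r 1 u,
      Set.Icc.convexComb t (P.toEndOn (X.side f k).2 t) u) := by
  have : push P (X.square f k (r, t)) = pushSquare P f r k t :=
    UnitDisc.polarLift_polar (pushSquare_zero P f) (pushSquare_succ P f) r k t
  rw [this, pushSquare, if_neg hr]
  rfl

/-- The part of a complex on which `TwoComplex.push` is continuous. -/
def pushDom (X : TwoComplex.{u}) (P : EndPush) : Set X.Realization :=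
  {x | realizationLift (fun _ => 0 ∈ P.dom) (fun _ t => t ∈ P.dom)
    (fun f => UnitDisc.polarLift (n := X.size f) fun r _ t => r ≠ 0 ∧ t ∈ P.dom)
    (fun _ => rfl) (fun _ => by simpa using (P.symm_mem_iff (t := 0)))
    (fun f k t => by
      rw [← UnitDisc.polar_one, UnitDisc.polarLift_polar]
      · split_ifs <;> simp [P.symm_mem_iff]
      · simp
      · intro r k
        simpa using fun _ => (P.symm_mem_iff (t := 1))) x}

theorem square_mem_pushDom (P : EndPush) (f : X.F) (k : ZMod (X.size f)) (r t : I) :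
    X.square f k (r, t) ∈ X.pushDom P ↔ r ≠ 0 ∧ t ∈ P.dom := by
  refine Eq.to_iff <| UnitDisc.polarLift_polar (n := X.size f)
    (φ := fun r _ t => r ≠ 0 ∧ t ∈ P.dom) ?_ ?_ r k t
  · simp
  · intro r k
    simpa using fun _ => (P.symm_mem_iff (t := 1))

theorem IsPolygonQuotient.isOpen_pushDom (hX : X.IsPolygonQuotient) (P : EndPush) :
    IsOpen (X.pushDom P) := by
  refine hX.isOpen_of_square fun f k => ?_
  convert (isOpen_ne (x := (0 : I))).prod P.isOpen_dom using 1
  ext ⟨r, t⟩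
  exact square_mem_pushDom P f k r t

theorem IsPolygonQuotient.continuousOn_push (hX : X.IsPolygonQuotient) (P : EndPush) :
    ContinuousOn (push P) (X.pushDom P) := by
  refine hX.continuousOn_of_square (hX.isOpen_pushDom P) fun f k => ?_
  rw [continuousOn_iff_continuous_domRestrict]
  refine ContinuousMap.continuous_of_continuous_uncurry _ ?_
  have hm : ∀ p : X.square f k ⁻¹' X.pushDom P, p.1.1 ≠ 0 ∧ p.1.2 ∈ P.dom := fun p =>
    (square_mem_pushDom P f k p.1.1 p.1.2).1 p.2
  have hc : Continuous fun p : X.square f k ⁻¹' X.pushDom P =>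
      P.toEndOn (X.side f k).2 p.1.2 :=
    (P.continuousOn_toEndOn _).comp_continuous (by fun_prop) fun p => (hm p).2
  have h1 : Continuous fun p : (X.square f k ⁻¹' X.pushDom P) × I =>
      Set.Icc.convexComb p.1.1.1 1 p.2 :=
    Set.Icc.continuous_convexComb_prod.comp
      (f := fun p : (X.square f k ⁻¹' X.pushDom P) × I => (p.1.1.1, (1 : I), p.2)) (by fun_prop)
  have h2 : Continuous fun p : (X.square f k ⁻¹' X.pushDom P) × I =>
      Set.Icc.convexComb p.1.1.2 (P.toEndOn (X.side f k).2 p.1.1.2) p.2 :=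
    Set.Icc.continuous_convexComb_prod.comp
      (f := fun p : (X.square f k ⁻¹' X.pushDom P) × I =>
        (p.1.1.2, P.toEndOn (X.side f k).2 p.1.1.2, p.2))
      (Continuous.prodMk (by fun_prop) ((hc.comp continuous_fst).prodMk continuous_snd))
  exact ((X.square f k).continuous.comp (h1.prodMk h2)).congr fun p =>
    (push_square P f k (hm p.1).1 _ _).symm

/-- On its domain, `TwoComplex.push` moves every point within the polygon to a corner. -/
theorem exists_path_push (P : EndPush) {f : X.F} {z : UnitDisc}
    (hz : X.face f z ∈ X.pushDom P) :
    ∃ k, ∃ δ : Path z (sidePt (X.size f) k 0), ∀ u, push P (X.face f z) u = X.face f (δ u) := by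
  obtain ⟨⟨r, k, t⟩, rfl⟩ := UnitDisc.exists_polar_eq (n := X.size f) z
  obtain ⟨hr, ht⟩ := (square_mem_pushDom P f k r t).1 hz
  obtain ⟨l, hl⟩ : ∃ l, sidePt (X.size f) l 0 = sidePt _ k (P.toEndOn (X.side f k).2 t) := by
    rcases P.toEndOn_eq_end (X.side f k).2 ht with h | h
    · exact ⟨k, by rw [h]⟩
    · exact ⟨k + 1, by rw [h, UnitDisc.sidePt_succ_zero]⟩
  refine ⟨l, ⟨⟨fun u => UnitDisc.polar _ (Set.Icc.convexComb r 1 u) k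
      (Set.Icc.convexComb t (P.toEndOn (X.side f k).2 t) u), ?_⟩, ?_, ?_⟩, fun u => ?_⟩
  · exact (UnitDisc.continuous_polar k).comp
      ((Set.Icc.continuous_convexComb _ _).prodMk (Set.Icc.continuous_convexComb _ _))
  · simp
  · simp [UnitDisc.polar_one, hl]
  · exact push_square P f k hr t u

/-- The path of a point of the interior of a polygon, when it moves straight to the corner with
number `0`.  The paths of all other points are constant. -/
noncomputable def coneOff : X.Realization → C(I, X.Realization) :=
  realizationLift (fun v => .const _ (X.vertex v)) (fun e t => .const _ (X.edge e t))
    (fun f z => open Classical in if ‖(z : ℂ)‖ < 1 then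
        (X.face f).comp ⟨fun u => z.segment (sidePt (X.size f) 0 0) u,
          UnitDisc.continuous_segment.comp (by fun_prop : Continuous fun u => (z, _, u))⟩
      else .const _ (X.face f z))
    (fun e => by rw [edge_zero]) (fun e => by rw [edge_one])
    (fun f k t => by
      rw [if_neg, face_sidePt]
      rw [← UnitDisc.polar_one, UnitDisc.norm_polar]
      simp)

/-- The union of the interiors of the polygons. -/
def interiors (X : TwoComplex.{u}) : Set X.Realization :=
  {x | realizationLift (fun _ => False) (fun _ _ => False) (fun _ z => ‖(z : ℂ)‖ < 1)
    (fun _ => rfl) (fun _ => rfl)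
    (fun f k t => by
      rw [← UnitDisc.polar_one, UnitDisc.norm_polar]
      simp) x}

theorem face_mem_interiors (f : X.F) (z : UnitDisc) :
    X.face f z ∈ X.interiors ↔ ‖(z : ℂ)‖ < 1 := Iff.rfl

theorem coneOff_face {f : X.F} {z : UnitDisc} (hz : ‖(z : ℂ)‖ < 1) (u : I) :
    coneOff (X.face f z) u = X.face f (z.segment (sidePt (X.size f) 0 0) u) := by
  have : coneOff (X.face f z) = if ‖(z : ℂ)‖ < 1 then _ else _ := rfl
  rw [this, if_pos hz]
  rfl

theorem IsPolygonQuotient.isOpen_interiors (hX : X.IsPolygonQuotient) : IsOpen X.interiors := by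
  refine hX.isOpen_of_square fun f k => ?_
  have : Continuous fun p : I × I => ‖(UnitDisc.polar (X.size f) p.1 k p.2 : ℂ)‖ :=
    (continuous_subtype_val.comp (UnitDisc.continuous_polar k)).norm
  exact isOpen_lt this continuous_const

theorem IsPolygonQuotient.continuousOn_coneOff (hX : X.IsPolygonQuotient) :
    ContinuousOn coneOff X.interiors := by
  refine hX.continuousOn_of_square hX.isOpen_interiors fun f k => ?_
  rw [continuousOn_iff_continuous_domRestrict]
  refine ContinuousMap.continuous_of_continuous_uncurry _ ?_
  have h1 : Continuous fun p : (X.square f k ⁻¹' X.interiors) × I =>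
      (UnitDisc.polar (X.size f) p.1.1.1 k p.1.1.2).segment (sidePt (X.size f) 0 0) p.2 :=
    UnitDisc.continuous_segment.comp (((UnitDisc.continuous_polar k).comp (by fun_prop)).prodMk
      (continuous_const.prodMk continuous_snd))
  exact ((X.face f).continuous.comp h1).congr fun p => (coneOff_face p.1.2 _).symm

theorem exists_path_coneOff {f : X.F} {z : UnitDisc} (hz : X.face f z ∈ X.interiors) :
    ∃ k, ∃ δ : Path z (sidePt (X.size f) k 0), ∀ u, coneOff (X.face f z) u = X.face f (δ u) :=
  ⟨0, ⟨⟨fun u => z.segment (sidePt (X.size f) 0 0) u,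
      UnitDisc.continuous_segment.comp (by fun_prop : Continuous fun u => (z, _, u))⟩,
    UnitDisc.segment_zero _ _, UnitDisc.segment_one _ _⟩, coneOff_face hz⟩

/-! ### Generators and relations of the fundamental group of a complex with one vertex -/

section OneVertex

variable [Subsingleton X.V] (v : X.V)

/-- The loop around the edge `e` of a complex with one vertex. -/
def edgeLoop (e : X.E) : Path (X.vertex v) (X.vertex v) :=
  ⟨X.edge e, (edge_zero e).trans (by rw [Subsingleton.elim v]),
    (edge_one e).trans (by rw [Subsingleton.elim v])⟩

/-- The image of a path between corners of a polygon, as a loop in a complex with one vertex. -/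
noncomputable def cornerLoop {f : X.F} {k l : ZMod (X.size f)}
    (δ : Path (sidePt _ k 0) (sidePt _ l 0)) : Path (X.vertex v) (X.vertex v) :=
  (δ.map (X.face f).continuous).cast (face_corner v f k).symm (face_corner v f l).symm

theorem cornerLoop_trans {f : X.F} {k l m : ZMod (X.size f)}
    (δ : Path (sidePt _ k 0) (sidePt _ l 0)) (δ' : Path (sidePt _ l 0) (sidePt _ m 0)) :
    cornerLoop v (δ.trans δ') = (cornerLoop v δ).trans (cornerLoop v δ') := by
  unfold cornerLoop
  rw [Path.map_trans, Path.cast_trans]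

/-- As the disc is convex, the homotopy class of a corner loop depends on the corners only. -/
theorem cornerLoop_homotopic {f : X.F} {k l : ZMod (X.size f)}
    (δ δ' : Path (sidePt _ k 0) (sidePt _ l 0)) :
    (cornerLoop v δ).Homotopic (cornerLoop v δ') :=
  ((SimplyConnectedSpace.paths_homotopic δ δ').map (X.face f)).pathCast _ _

theorem cornerLoop_homotopic_refl {f : X.F} {k l : ZMod (X.size f)} (h : l = k)
    (δ : Path (sidePt _ k 0) (sidePt _ l 0)) : (cornerLoop v δ).Homotopic (.refl _) := by
  subst h
  have hr : cornerLoop v (Path.refl (sidePt (X.size f) l 0)) = .refl _ := by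
    ext u
    exact face_corner v f l
  rw [← hr]
  exact cornerLoop_homotopic v _ _

/-- The path along the side `k` of an `n`-gon. -/
noncomputable def sidePath (n : ℕ) [NeZero n] (k : ZMod n) :
    Path (sidePt n k 0) (sidePt n (k + 1) 0) :=
  ⟨⟨sidePt n k, UnitDisc.continuous_sidePt k⟩, rfl, (UnitDisc.sidePt_succ_zero k).symm⟩

theorem cornerLoop_sidePath_of_pos {f : X.F} {k : ZMod (X.size f)} (h : (X.side f k).2 = true) :
    cornerLoop v (sidePath _ k) = edgeLoop v (X.side f k).1 := by
  ext t
  exact (face_sidePt f k t).trans (by rw [if_pos h]; rfl)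

theorem cornerLoop_sidePath_of_neg {f : X.F} {k : ZMod (X.size f)} (h : (X.side f k).2 = false) :
    cornerLoop v (sidePath _ k) = (edgeLoop v (X.side f k).1).symm := by
  ext t
  exact (face_sidePt f k t).trans (by rw [if_neg (by simp [h])]; rfl)

/-- The boundary loop of a triangle is null-homotopic. -/
theorem cornerLoop_triangle {f : X.F} (hf : X.size f = 3) :
    ((Path.Homotopic.Quotient.mk (cornerLoop v (sidePath (X.size f) 0))).trans
      (.mk (cornerLoop v (sidePath (X.size f) (0 + 1))))).trans
        (.mk (cornerLoop v (sidePath (X.size f) (0 + 1 + 1)))) = .refl _ := by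
  have h0 : (0 + 1 + 1 + 1 : ZMod (X.size f)) = 0 := by
    have := (ZMod.natCast_eq_zero_iff 3 (X.size f)).2 (by rw [hf])
    linear_combination this
  rw [← Path.Homotopic.Quotient.mk_trans, ← Path.Homotopic.Quotient.mk_trans, ← cornerLoop_trans,
    ← cornerLoop_trans]
  exact Path.Homotopic.Quotient.eq.2 (cornerLoop_homotopic_refl v h0 _)

variable {v} in
theorem cornerLoop_mem {N : Subgroup (FundamentalGroup X.Realization (X.vertex v))}
    (hN : ∀ e, FundamentalGroup.fromPath (.mk (edgeLoop v e)) ∈ N)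
    {f : X.F} {k l : ZMod (X.size f)} (δ : Path (sidePt _ k 0) (sidePt _ l 0)) :
    FundamentalGroup.fromPath (.mk (cornerLoop v δ)) ∈ N := by
  -- walk from the corner `k` to the corner `l` along `m` consecutive sides
  obtain ⟨m, hm⟩ : ∃ m : ℕ, l = k + m := ⟨(l - k).val, by simp⟩
  induction m generalizing l with
  | zero =>
    have : Path.Homotopic.Quotient.mk (cornerLoop v δ) = .mk (.refl _) :=
      Path.Homotopic.Quotient.eq.2 (cornerLoop_homotopic_refl v (by simpa using hm) δ)
    rw [this]
    exact N.one_mem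
  | succ m ih =>
    obtain rfl : l = k + m + 1 := by rw [hm]; push_cast; ring
    let δ₁ : Path (sidePt (X.size f) k 0) (sidePt (X.size f) (k + m) 0) :=
      PathConnectedSpace.somePath _ _
    have h1 := ih δ₁ rfl
    have h2 : FundamentalGroup.fromPath (.mk (cornerLoop v (sidePath (X.size f) (k + m)))) ∈ N := by
      cases h : (X.side f (k + m)).2
      · rw [cornerLoop_sidePath_of_neg v h]
        exact N.inv_mem (hN _)
      · rw [cornerLoop_sidePath_of_pos v h]
        exact hN _
    have : Path.Homotopic.Quotient.mk (cornerLoop v δ) =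
        (Path.Homotopic.Quotient.mk (cornerLoop v δ₁)).trans
          (.mk (cornerLoop v (sidePath (X.size f) (k + m)))) := by
      rw [← Path.Homotopic.Quotient.mk_trans, ← cornerLoop_trans]
      exact Path.Homotopic.Quotient.eq.2 (cornerLoop_homotopic v _ _)
    rw [this]
    exact N.mul_mem h2 h1

variable {v} in
/-- The fundamental group of a polygon quotient with one vertex is generated by the edges.
The sets on which edge points are not midpoints, on which edge points are not vertices, and the
interiors of the polygons form an open cover, and each set is contracted to the vertex by moving
every point within its polygon to a corner.  So any two contractions differ by paths between
corners of a polygon. -/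
theorem IsPolygonQuotient.subgroup_eq_top (hX : X.IsPolygonQuotient)
    {N : Subgroup (FundamentalGroup X.Realization (X.vertex v))}
    (hN : ∀ e, FundamentalGroup.fromPath (.mk (edgeLoop v e)) ∈ N) : N = ⊤ := by
  let P : Bool → EndPush := fun b => if b then .halves else .interior
  let U : Option Bool → Set X.Realization := fun i => i.elim X.interiors fun b => X.pushDom (P b)
  let H : Option Bool → X.Realization → C(I, X.Realization) := fun i =>
    i.elim coneOff fun b => push (P b)
  have key : ∀ i f z, X.face f z ∈ U i → ∃ k, ∃ δ : Path z (sidePt (X.size f) k 0),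
      ∀ u, H i (X.face f z) u = X.face f (δ u) := by
    rintro (_ | b) f z hz
    · exact exists_path_coneOff hz
    · exact exists_path_push (P b) hz
  have hface : ∀ x, ∃ f z, X.face f z = x := fun x => by
    obtain ⟨f, k, r, t, h⟩ := hX.exists_square_eq x
    exact ⟨f, _, h⟩
  have hv : X.vertex v ∈ X.pushDom .halves := by
    change ((0 : I) : ℝ) ≠ 1 / 2
    norm_num
  refine FundamentalGroup.subgroup_eq_top_of_open_cover N U ?_ ?_ H ?_ ?_ ?_ ?_ (some true) hv
    fun u => rfl
  · rintro (_ | b)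
    exacts [hX.isOpen_interiors, hX.isOpen_pushDom _]
  · intro x
    obtain ⟨f, k, r, t, rfl⟩ := hX.exists_square_eq x
    by_cases hr : r = 0
    · refine ⟨none, (face_mem_interiors _ _).2 ?_⟩
      exact (UnitDisc.norm_polar r k t).trans_lt (by simp [hr])
    · by_cases ht : (t : ℝ) = 1 / 2
      · refine ⟨some false, (square_mem_pushDom _ f k r t).2 ⟨hr, ?_, ?_⟩⟩ <;> rintro rfl <;>
          norm_num at ht
      · exact ⟨some true, (square_mem_pushDom _ f k r t).2 ⟨hr, ht⟩⟩
  · rintro (_ | b)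
    exacts [hX.continuousOn_coneOff, hX.continuousOn_push _]
  · intro i x hx
    obtain ⟨f, z, rfl⟩ := hface x
    obtain ⟨k, δ, h⟩ := key i f z hx
    rw [h, δ.source]
  · intro i x hx
    obtain ⟨f, z, rfl⟩ := hface x
    obtain ⟨k, δ, h⟩ := key i f z hx
    rw [h, δ.target, face_corner v]
  · intro i j x T T' hi hj hT hT'
    obtain ⟨f, z, rfl⟩ := hface x
    obtain ⟨k, δ, h⟩ := key i f z hi
    obtain ⟨k', δ', h'⟩ := key j f z hj
    -- both tracks of the point run in the polygon `f`, from one and the same preimage `z`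
    convert cornerLoop_mem hN (δ.symm.trans δ') using 2
    rw [← Path.Homotopic.Quotient.mk_symm, ← Path.Homotopic.Quotient.mk_trans]
    congr 1
    rw [cornerLoop, Path.map_trans, Path.cast_trans _ _ _ rfl]
    congr 1
    · ext u
      exact (hT _).symm.trans (h _)
    · ext u
      exact (hT' _).symm.trans (h' _)

end OneVertex

end TwoComplex

/-! ### A free action on a space of step functions -/

/-- The functions from the half-open unit interval to `G`, at the distance given by the Lebesgue
outer measure of the set on which they differ.  All functions are admitted, and functions which
differ on a null set are not identified, so the distance is a pseudometric. -/
def UnitIntervalFun (G : Type*) : Type _ := Set.Ico (0 : ℝ) 1 → G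

namespace UnitIntervalFun

open MeasureTheory

variable {G : Type*}

/-- The set of real numbers at which two functions differ. -/
def differSet (f h : UnitIntervalFun G) : Set ℝ := {x | ∃ s : Set.Ico (0 : ℝ) 1, s = x ∧ f s ≠ h s}

theorem differSet_subset_union (f h k : UnitIntervalFun G) :
    differSet f k ⊆ differSet f h ∪ differSet h k := by
  rintro _ ⟨s, rfl, hs⟩
  by_cases h1 : f s = h s
  · exact .inr ⟨s, rfl, fun h2 => hs (h1.trans h2)⟩
  · exact .inl ⟨s, rfl, h1⟩

noncomputable instance : PseudoEMetricSpace (UnitIntervalFun G) where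
  edist f h := volume (differSet f h)
  edist_self f := by simp [differSet]
  edist_comm f h := by simp only [differSet, ne_comm]
  edist_triangle f h k := (measure_mono (differSet_subset_union f h k)).trans
    (measure_union_le _ _)

theorem edist_def (f h : UnitIntervalFun G) : edist f h = volume (differSet f h) := rfl

/-- The constant functions. -/
def const (g : G) : UnitIntervalFun G := fun _ => g

/-- The function that agrees with `f` to the left of `a` and with `h` from `a` on. -/
noncomputable def cut (a : ℝ) (f h : UnitIntervalFun G) : UnitIntervalFun G :=
  fun s => if (s : ℝ) < a then f s else h s

theorem cut_zero (f h : UnitIntervalFun G) : cut 0 f h = h := by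
  funext s
  exact if_neg (not_lt.2 s.2.1)

theorem cut_one (f h : UnitIntervalFun G) : cut 1 f h = f := by
  funext s
  exact if_pos s.2.2

theorem edist_cut_le (a a' : ℝ) (f f' h h' : UnitIntervalFun G) :
    edist (cut a f h) (cut a' f' h') ≤ edist a a' + edist f f' + edist h h' := by
  have h1 : volume (Set.Ico (min a a') (max a a')) = edist a a' := by
    rw [Real.volume_Ico, edist_dist, Real.dist_eq, max_sub_min_eq_abs']
  rw [← h1, edist_def, edist_def, edist_def]
  refine (measure_mono ?_).trans ((measure_union_le _ _).trans
    (add_le_add_left (measure_union_le _ _) _))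
  rintro _ ⟨s, rfl, hs⟩
  by_contra hc
  simp only [Set.mem_union, not_or, Set.mem_Ico, not_and, not_lt, min_le_iff, max_le_iff] at hc
  obtain ⟨⟨hc1, hc2⟩, hc3⟩ := hc
  have hf : f s = f' s := by_contra fun h => hc2 ⟨s, rfl, h⟩
  have hh : h s = h' s := by_contra fun h => hc3 ⟨s, rfl, h⟩
  apply hs
  unfold cut
  by_cases h2 : (s : ℝ) < a <;> by_cases h3 : (s : ℝ) < a'
  · rw [if_pos h2, if_pos h3, hf]
  · exact absurd (hc1 (.inr (not_lt.1 h3))).1 (not_le.2 h2)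
  · exact absurd (hc1 (.inl (not_lt.1 h2))).2 (not_le.2 h3)
  · rw [if_neg h2, if_neg h3, hh]

theorem continuous_cut : Continuous fun p : ℝ × UnitIntervalFun G × UnitIntervalFun G =>
    cut p.1 p.2.1 p.2.2 := by
  refine LipschitzWith.continuous (K := 3) fun p q => (edist_cut_le _ _ _ _ _ _).trans ?_
  have h1 : edist p.1 q.1 ≤ edist p q := le_max_left _ _
  have h2 : edist p.2 q.2 ≤ edist p q := le_max_right _ _
  have h3 : edist p.2.1 q.2.1 ≤ edist p q := (le_max_left _ _).trans h2
  have h4 : edist p.2.2 q.2.2 ≤ edist p q := (le_max_right _ _).trans h2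
  calc _ ≤ edist p q + edist p q + edist p q := by gcongr
    _ = _ := by push_cast; ring

theorem continuous_cut_comp {a b : UnitIntervalFun G} {τ : I → I} (hτ : Continuous τ) :
    Continuous fun t => cut (τ t) a b :=
  continuous_cut.comp (g := fun p : ℝ × UnitIntervalFun G × UnitIntervalFun G =>
    cut p.1 p.2.1 p.2.2) (f := fun t => ((τ t : ℝ), a, b)) (by fun_prop)

variable [Group G]

instance : MulAction G (UnitIntervalFun G) where
  smul g f := fun s => g * f s
  one_smul _ := funext fun _ => one_mul _
  mul_smul _ _ _ := funext fun _ => mul_assoc _ _ _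

theorem smul_apply (g : G) (f : UnitIntervalFun G) (s : Set.Ico (0 : ℝ) 1) :
    (g • f) s = g * f s := rfl

theorem smul_cut (g : G) (a : ℝ) (f h : UnitIntervalFun G) :
    g • cut a f h = cut a (g • f) (g • h) := by
  funext s
  simp only [smul_apply, cut]
  split_ifs <;> rfl

theorem smul_const (g h : G) : g • const h = const (g * h) := rfl

variable (G) in
/-- The quotient of the function space by the left translations. -/
abbrev Orbits : Type _ := MulAction.orbitRel.Quotient G (UnitIntervalFun G)

variable (G) in
/-- A nontrivial left translation moves every function to distance `1`, so it moves
every ball of radius `1 / 2` off itself. -/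
theorem isQuotientCoveringMap :
    IsQuotientCoveringMap (Quotient.mk _ : UnitIntervalFun G → Orbits G) G where
  __ := isQuotientMap_quot_mk
  continuous_const_smul g := by
    refine Isometry.continuous fun f h => ?_
    simp only [edist_def, differSet, smul_apply, ne_eq, mul_right_inj]
  apply_eq_iff_mem_orbit := Quotient.eq
  disjoint f := by
    -- two points of this ball are at distance less than `1`
    refine ⟨Metric.eball f (1 / 2), Metric.eball_mem_nhds f (by simp), ?_⟩
    rintro g ⟨_, ⟨h, hh, rfl⟩, hgh⟩
    by_contra hg
    have h1 : edist (g • h) h = 1 := by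
      have : differSet (g • h) h = Set.Ico 0 1 := by
        ext x
        simp [differSet, smul_apply, hg]
      rw [edist_def, this, Real.volume_Ico]
      simp
    have h2 := (edist_triangle_right (g • h) h f).trans_lt (ENNReal.add_lt_add hgh hh)
    rw [h1, ENNReal.add_halves] at h2
    exact lt_irrefl _ h2

end UnitIntervalFun

/-! ### The triangle complex of a group -/

namespace TwoComplex

/-- The boundary path `g, h, (g * h)⁻¹` of a triangle, as a sequence of oriented edges. -/
def triangleSide {G : Type*} [Group G] (g h : G) (k : ZMod 3) : G × Bool :=
  (![(g, true), (h, true), (g * h, false)] : Fin 3 → G × Bool) k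

/-- The complex with one vertex, an edge for every element of `G`, and a triangle with boundary
path `g, h, (g * h)⁻¹` for all `g` and `h`: the presentation complex of the multiplication table
of `G`. -/
def ofGroup (G : Type u) [Group G] : TwoComplex.{u} where
  V := PUnit
  E := G
  src _ := PUnit.unit
  tgt _ := PUnit.unit
  F := G × G
  size _ := 3
  size_pos _ := by norm_num
  side f := triangleSide f.1 f.2
  closed _ _ := rfl

variable (G : Type u) [Group G]

/-- The vertex of the triangle complex. -/
def ofGroupVertex : (ofGroup G).V := PUnit.unit

instance : Subsingleton (ofGroup G).V := inferInstanceAs (Subsingleton PUnit)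

theorem ofGroup_isPolygonQuotient : (ofGroup G).IsPolygonQuotient :=
  ⟨fun _ => ⟨((1 : G), true), rfl⟩, fun e => ⟨((e, 1) : G × G), (0 : ZMod 3), rfl⟩⟩

/-- The triangle `g, h, (g * h)⁻¹` has a corner between the terminal end of `g` and the initial end
of `h`.  So the links contain a complete bipartite graph. -/
theorem ofGroup_isLinkConnected : (ofGroup G).IsLinkConnected := by
  refine ⟨ofGroup_isPolygonQuotient G, fun v => ?_⟩
  have hadj : ∀ g h : G, ((ofGroup G).link v).Adj ⟨(g, false), rfl⟩ ⟨(h, true), rfl⟩ :=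
    fun g h => (SimpleGraph.fromRel_adj _ _ _).2
      ⟨fun e => Bool.noConfusion (congrArg (fun a => a.1.2) e),
        .inl ⟨((g, h) : G × G), (0 : ZMod 3), rfl, rfl⟩⟩
  have h1 : ∀ d, ((ofGroup G).link v).Reachable ⟨((1 : G), false), rfl⟩ d := by
    rintro ⟨⟨g, b⟩, -⟩
    cases b
    · exact (hadj 1 1).reachable.trans (hadj g 1).symm.reachable
    · exact (hadj 1 g).reachable
  have : Nonempty {d : (ofGroup G).E × Bool // (ofGroup G).origin d = v} :=
    ⟨⟨((1 : G), false), rfl⟩⟩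
  exact ⟨fun a b => (h1 a).symm.trans (h1 b)⟩

theorem IsPolygonQuotient.pathConnectedSpace {X : TwoComplex.{u}} [Subsingleton X.V]
    (hX : X.IsPolygonQuotient) (v : X.V) : PathConnectedSpace X.Realization := by
  have h : ∀ x, Joined x (X.vertex v) := fun x => by
    obtain ⟨f, k, r, t, rfl⟩ := hX.exists_square_eq x
    rw [square_apply, ← face_corner v f k]
    exact ⟨(PathConnectedSpace.somePath _ _).map (X.face f).continuous⟩
  exact ⟨⟨X.vertex v⟩, fun x y => (h x).trans (h y).symm⟩

/-- The element of the fundamental group of `TwoComplex.ofGroup G` given by an edge.  The inverse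
makes up for the order of multiplication in Mathlib's fundamental group, where `p * q` is first `q`
and then `p`. -/
noncomputable def ofGroupHom :
    G →* FundamentalGroup (ofGroup G).Realization ((ofGroup G).vertex (ofGroupVertex G)) :=
  MonoidHom.mk' (fun g => (FundamentalGroup.fromPath (.mk (edgeLoop (ofGroupVertex G) g)))⁻¹) <| by
    intro g h
    rw [← mul_inv_rev, inv_inj]
    let f : (ofGroup G).F := ((g, h) : G × G)
    have key := cornerLoop_triangle (ofGroupVertex G) (f := f) rfl
    have h0 : (ofGroup G).side f 0 = ((g, true) : G × Bool) := rfl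
    have h1 : (ofGroup G).side f (0 + 1) = ((h, true) : G × Bool) := rfl
    have h2 : (ofGroup G).side f (0 + 1 + 1) = ((g * h, false) : G × Bool) := rfl
    rw [cornerLoop_sidePath_of_pos _ (by rw [h0]), cornerLoop_sidePath_of_pos _ (by rw [h1]),
      cornerLoop_sidePath_of_neg _ (by rw [h2]), h0, h1, h2] at key
    exact inv_mul_eq_one.1 key

theorem ofGroupHom_surjective : Function.Surjective (ofGroupHom G) := by
  rw [← MonoidHom.range_eq_top]
  refine (ofGroup_isPolygonQuotient G).subgroup_eq_top fun g => ?_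
  rw [← inv_mem_iff]
  exact ⟨g, rfl⟩

/-! ### The triangle complex maps to the orbit space -/

open UnitIntervalFun

variable {G}

/-- The boundary of the triangle `g, h, (g * h)⁻¹`, lifted to the space of functions: the value of
the function switches from `1` to `g`, then from `g` to `g * h`, and back to `1`. -/
noncomputable def triangleLift (g h : G) (k : ZMod 3) (t : I) : UnitIntervalFun G :=
  (![cut t (const g) (const 1), cut t (const (g * h)) (const g),
    cut (σ t) (const (g * h)) (const 1)] : Fin 3 → UnitIntervalFun G) k

theorem triangleLift_succ (g h : G) (k : ZMod 3) :
    triangleLift g h (k + 1) 0 = triangleLift g h k 1 := by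
  fin_cases k
  · change cut ((0 : I) : ℝ) (const (g * h)) (const g) = cut ((1 : I) : ℝ) (const g) (const 1)
    simp [cut_zero, cut_one]
  · change cut (σ (0 : I) : ℝ) (const (g * h)) (const 1) =
      cut ((1 : I) : ℝ) (const (g * h)) (const g)
    simp [cut_one]
  · change cut ((0 : I) : ℝ) (const g) (const 1) =
      cut (σ (1 : I) : ℝ) (const (g * h)) (const 1)
    simp [cut_zero]

theorem continuous_triangleLift (g h : G) (k : ZMod 3) : Continuous (triangleLift g h k) := by
  fin_cases k
  · exact continuous_cut_comp continuous_id
  · exact continuous_cut_comp continuous_id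
  · exact continuous_cut_comp continuous_symm

/-- The triangle is filled by cutting off the functions of its boundary at the radius. -/
noncomputable def triangleFill (g h : G) (r : I) (k : ZMod 3) (t : I) : Orbits G :=
  Quotient.mk _ (cut r (triangleLift g h k t) (const 1))

theorem triangleFill_zero (g h : G) (k k' : ZMod 3) (t t' : I) :
    triangleFill g h 0 k t = triangleFill g h 0 k' t' := by
  simp [triangleFill, cut_zero]

theorem triangleFill_succ (g h : G) (r : I) (k : ZMod 3) :
    triangleFill g h r (k + 1) 0 = triangleFill g h r k 1 := by
  rw [triangleFill, triangleFill, triangleLift_succ]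

theorem mk_smul_eq (g : G) (f : UnitIntervalFun G) :
    (Quotient.mk _ (g • f) : Orbits G) = Quotient.mk _ f :=
  Quotient.sound ⟨g, rfl⟩

theorem mk_const_eq (g : G) :
    (Quotient.mk _ (const g) : Orbits G) = Quotient.mk _ (const 1) := by
  simpa only [smul_const, mul_one] using mk_smul_eq g (const (1 : G))

theorem triangleFill_side (g h : G) (k : ZMod 3) (t : I) :
    UnitDisc.polarLift (triangleFill g h) (sidePt 3 k t) =
      Quotient.mk _ (cut (if (triangleSide g h k).2 then t else σ t : I)
        (const (triangleSide g h k).1) (const 1)) := by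
  rw [← UnitDisc.polar_one,
    UnitDisc.polarLift_polar (triangleFill_zero g h) (triangleFill_succ g h),
    triangleFill, Set.Icc.coe_one, cut_one]
  fin_cases k
  · rfl
  · change (Quotient.mk _ (cut t (const (g * h)) (const g)) : Orbits G) =
      Quotient.mk _ (cut t (const h) (const 1))
    rw [← mk_smul_eq g (cut t (const h) (const 1)), smul_cut, smul_const, smul_const, mul_one]
  · rfl

/-- The map that sends an edge `g` to the image of the path from `1` to `g` in the space of
functions. -/
noncomputable def toOrbitsFun : (ofGroup G).Realization → Orbits G :=
  realizationLift (X := ofGroup G) (fun _ => Quotient.mk _ (const 1))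
    (fun g t => Quotient.mk _ (cut t (const (G := G) g) (const 1)))
    (fun f => UnitDisc.polarLift (n := 3) (triangleFill (G := G) f.1 f.2))
    (fun _ => by simp [cut_zero])
    (fun g => by simpa [cut_one] using mk_const_eq (G := G) g)
    (fun f k t => triangleFill_side (G := G) f.1 f.2 k t)

theorem continuous_toOrbitsFun : Continuous (toOrbitsFun (G := G)) := by
  refine (ofGroup_isPolygonQuotient G).continuous_of_square fun f k => ?_
  obtain ⟨g, h⟩ : G × G := f
  change ZMod 3 at k
  have h1 : Continuous fun p : I × I => triangleFill g h p.1 k p.2 :=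
    continuous_quot_mk.comp <| continuous_cut.comp <|
      (continuous_subtype_val.comp continuous_fst).prodMk <|
        ((continuous_triangleLift g h k).comp continuous_snd).prodMk continuous_const
  refine h1.congr fun p => ?_
  exact (UnitDisc.polarLift_polar (triangleFill_zero g h) (triangleFill_succ g h) p.1 k p.2).symm

/-- A lift of the loop around the edge `g` ends at the translate by `g` of its starting point. -/
theorem ofGroupHom_injective : Function.Injective (ofGroupHom G) := by
  rw [injective_iff_map_eq_one]
  intro g hg
  have hg' : Path.Homotopic.Quotient.mk (edgeLoop (ofGroupVertex G) g) = .refl _ :=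
    inv_eq_one (α := FundamentalGroup _ _) |>.1 hg
  have cov := (isQuotientCoveringMap G).isCoveringMap
  let θ : C((ofGroup G).Realization, Orbits G) := ⟨toOrbitsFun, continuous_toOrbitsFun⟩
  let Γ : Path (const 1 : UnitIntervalFun G) (const g) :=
    ⟨⟨fun t => cut t (const g) (const 1), continuous_cut_comp continuous_id⟩,
      cut_zero _ _, cut_one _ _⟩
  let x : Orbits G := Quotient.mk _ (const 1)
  let e₁ : (Quotient.mk _ : UnitIntervalFun G → Orbits G) ⁻¹' {x} := ⟨const 1, rfl⟩
  let e₂ : (Quotient.mk _ : UnitIntervalFun G → Orbits G) ⁻¹' {x} := ⟨const g, mk_const_eq g⟩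
  have h1 : cov.monodromy (Path.Homotopic.Quotient.map
      (.mk (edgeLoop (ofGroupVertex G) g)) θ : Path.Homotopic.Quotient x x) e₁ = e₂ :=
    cov.monodromy_eq_of_map_eq (.mk Γ) rfl
  have h2 : cov.monodromy (Path.Homotopic.Quotient.map
      (.refl ((ofGroup G).vertex (ofGroupVertex G))) θ : Path.Homotopic.Quotient x x) e₁ = e₁ :=
    congrFun cov.monodromy_refl e₁
  rw [hg', h2] at h1
  exact (congrFun (congrArg Subtype.val h1) ⟨0, by simp⟩).symm

end TwoComplex

/-! ### Wedge products -/

/-- Homeomorphic spaces have isomorphic fundamental groups. -/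
noncomputable def FundamentalGroup.congrHomeomorph {X Y : Type*} [TopologicalSpace X]
    [TopologicalSpace Y] (h : X ≃ₜ Y) (x : X) :
    FundamentalGroup X x ≃* FundamentalGroup Y (h x) :=
  MulEquiv.ofBijective (FundamentalGroup.map (h : C(X, Y)) x) <| by
    constructor
    · rintro ⟨p⟩ ⟨q⟩ hpq
      have h1 : (p.map h.continuous).Homotopic (q.map h.continuous) :=
        Path.Homotopic.Quotient.exact hpq
      have h2 := (h1.map (h.symm : C(Y, X))).pathCast (h.symm_apply_apply x).symm
        (h.symm_apply_apply x).symm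
      refine Path.Homotopic.Quotient.eq.2 ?_
      convert h2 using 1 <;> ext u <;> simp
    · rintro ⟨q⟩
      refine ⟨FundamentalGroup.fromPath (.mk ((q.map h.symm.continuous).cast
        (h.symm_apply_apply x).symm (h.symm_apply_apply x).symm)), ?_⟩
      refine congrArg Path.Homotopic.Quotient.mk ?_
      ext u
      simp

/-- The wedge product of a single complex and no circles is the space of that complex. -/
def wedgeSpaceHomeomorph (X : TwoComplex.{u}) (v : X.V) :
    X.Realization ≃ₜ WedgeSpace PEmpty.{u + 1} (fun _ : PUnit.{u + 1} => X) (fun _ => v) where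
  toFun x := Quot.mk _ (Sum.inr (Sum.inr ⟨PUnit.unit, x⟩))
  invFun := Quot.lift (Sum.elim (fun _ => X.vertex v)
      (Sum.elim (fun a => a.1.elim) fun a => a.2)) <| by
    rintro _ _ (s | j)
    · exact s.elim
    · rfl
  left_inv _ := rfl
  right_inv := by
    rintro ⟨⟨⟩ | ⟨⟨⟨⟩, _⟩ | ⟨⟨⟩, x⟩⟩⟩
    · exact Quot.sound (.complex PUnit.unit)
    · rfl
  continuous_toFun := continuous_quot_mk.comp <|
    continuous_inr.comp <| continuous_inr.comp continuous_sigmaMk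
  continuous_invFun := by
    refine continuous_quot_lift _ (continuous_const.sumElim (Continuous.sumElim ?_ ?_))
    · exact continuous_sigma fun s => s.elim
    · exact continuous_sigma fun _ => continuous_id

theorem mainTheorem3 (G : Type u) [Group G] :
    ∃ (S J : Type u) (K : J → TwoComplex.{u}) (v : (j : J) → (K j).V),
      (∀ j, (K j).IsLinkConnected ∧ ConnectedSpace (K j).Realization) ∧
        Nonempty (FundamentalGroup (WedgeSpace S K v) (wedgePoint S K v) ≃* G) := by
  let K := TwoComplex.ofGroup G
  let v : K.V := TwoComplex.ofGroupVertex G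
  have := (TwoComplex.ofGroup_isPolygonQuotient G).pathConnectedSpace v
  refine ⟨PEmpty, PUnit, fun _ => K, fun _ => v,
    fun _ => ⟨TwoComplex.ofGroup_isLinkConnected G,
      inferInstanceAs (ConnectedSpace K.Realization)⟩, ?_⟩
  have h : wedgeSpaceHomeomorph K v (K.vertex v) =
      wedgePoint PEmpty.{u + 1} (fun _ : PUnit.{u + 1} => K) (fun _ => v) :=
    Quot.sound (.complex PUnit.unit)
  rw [← h]
  exact ⟨((MulEquiv.ofBijective (TwoComplex.ofGroupHom G) ⟨TwoComplex.ofGroupHom_injective,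
    TwoComplex.ofGroupHom_surjective G⟩).trans
      (FundamentalGroup.congrHomeomorph (wedgeSpaceHomeomorph K v) _)).symm⟩
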